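/- Let $\gamma>1$, $\mu>0$, $c_0>0$ and $l\in\mathbb R$ be constants, and consider in $\mathbb R^3$ the system for an axisymmetric vortex with linear friction $$\dot A+2\gamma aA=0,\qquad \dot a+a^2-b^2+lb+2c_0A=-\mu a,\qquad \dot b+2ab-la=-\mu b .$$ (i) The system has exactly two equilibria, $(a,b,A)=(0,0,0)$ and $(a,b,A)=(-\mu,l,0)$. (ii) Both are unstable in the sense of Lyapunov. (iii) The eigenvalues (with multiplicity) of the linearized system are $2\gamma\mu>0$ and $\mu\pm il$ at $(-\mu,l,0)$, and $0$ and $-\mu\pm il$ at $(0,0,0)$. (iv) Let $\alpha,\beta$ be real functions of $A$, of class $C^2$ near $0$, with $\alpha(0)=\beta(0)=0$. The curve $a=\alpha(A)$, $b=\beta(A)$ is invariant up to second order, that is, with $\dot a,\dot b,\dot A$ the right-hand sides of the system at $(\alpha(A),\beta(A),A)$, $$\alpha'(A)\dot A-\dot a=O(A^2),\qquad \beta'(A)\dot A-\dot b=O(A^2)\qquad (A\to0),$$ if and only if $$\alpha'(0)=-\frac{2\mu c_0}{\mu^2+l^2},\qquad \beta'(0)=-\frac{2lc_0}{\mu^2+l^2};$$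 and in this case, along the curve, $\dot A=\dfrac{4\gamma\mu c_0}{\mu^2+l^2}\,A^2+O(A^3)$ as $A\to0$. -/

import Mathlib

open Set Filter Topology Asymptotics

/-- `x` solves the autonomous system `x' = F x` on the time interval `[0, T]`
(one-sided derivatives at the end points). -/
def IsSolutionOn {E : Type*} [NormedAddCommGroup E] [NormedSpace ℝ E]
    (F : E → E) (x : ℝ → E) (T : ℝ) : Prop :=
  ∀ t ∈ Icc 0 T, HasDerivWithinAt x (F (x t)) (Icc 0 T) t

/-- `p` is an equilibrium of `x' = F x`. -/
def IsEquilibrium {E : Type*} [NormedAddCommGroup E] [NormedSpace ℝ E]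
    (F : E → E) (p : E) : Prop :=
  F p = 0

/-- Stability of `p` in the sense of Lyapunov for `x' = F x`: every solution, on whatever interval
`[0, T]` it is given, stays `ε`-close to `p` if it starts `δ`-close to `p`. (Solutions are only
required to be local, so that a finite-time blow-up counts against stability.) -/
def IsLyapunovStable {E : Type*} [NormedAddCommGroup E] [NormedSpace ℝ E]
    (F : E → E) (p : E) : Prop :=
  ∀ ε > 0, ∃ δ > 0, ∀ (T : ℝ) (x : ℝ → E), 0 < T → IsSolutionOn F x T →
    ‖x 0 - p‖ < δ → ∀ t ∈ Icc 0 T, ‖x t - p‖ < ε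

/-- An equilibrium that is not stable in the sense of Lyapunov. -/
def IsUnstableEquilibrium {E : Type*} [NormedAddCommGroup E] [NormedSpace ℝ E]
    (F : E → E) (p : E) : Prop :=
  IsEquilibrium F p ∧ ¬ IsLyapunovStable F p

/-- The right-hand side of the axisymmetric vortex system with linear friction, in the
coordinates `(a, b, A)`:
`a' = -a² + b² - l b - 2 c₀ A - μ a`, `b' = -2 a b + l a - μ b`, `A' = -2 γ a A`. -/
def vortexField (γ l μ c₀ : ℝ) (p : ℝ × ℝ × ℝ) : ℝ × ℝ × ℝ :=
  (-p.1 ^ 2 + p.2.1 ^ 2 - l * p.2.1 - 2 * c₀ * p.2.2 - μ * p.1,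
   -2 * p.1 * p.2.1 + l * p.1 - μ * p.2.1,
   -2 * γ * p.1 * p.2.2)

/-- The eigenvalues in `ℂ`, with algebraic multiplicity, of the linearization of
`x' = F x` at `p`. -/
noncomputable def linearizationEigenvalues (F : ℝ × ℝ × ℝ → ℝ × ℝ × ℝ) (p : ℝ × ℝ × ℝ) :
    Multiset ℂ :=
  ((fderiv ℝ F p : ℝ × ℝ × ℝ →L[ℝ] ℝ × ℝ × ℝ) : ℝ × ℝ × ℝ →ₗ[ℝ] ℝ × ℝ × ℝ).charpoly.aroots ℂ

/-- The residual obtained by substituting `a = α A`, `b = β A` into the equations for `a'` and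
`b'` of the system `(a, b, A)' = F (a, b, A)`, namely
`(α'(A) A' - a', β'(A) A' - b')` at the point `(α A, β A, A)`.
It vanishes identically near `0` exactly when the curve is locally invariant. -/
noncomputable def substitutionResidual (F : ℝ × ℝ × ℝ → ℝ × ℝ × ℝ) (α β : ℝ → ℝ) (A : ℝ) : ℝ × ℝ :=
  (deriv α A * (F (α A, β A, A)).2.2 - (F (α A, β A, A)).1,
   deriv β A * (F (α A, β A, A)).2.2 - (F (α A, β A, A)).2.1)

/-! Both instabilities come from one Chetaev-type criterion, `not_isLyapunovStable_of_mul_sq_le`.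
Stability of a point of a C¹ field lets nearby solutions be continued for as long as desired. A
function `V` with `V' ≥ κ V²` that starts positive would then grow at a fixed rate, yet it is
bounded near the point.

At `(-μ, l, 0)` the unstable direction is linear and `V = A²` works. The origin has a zero
eigenvalue and is unstable only through the slow motion `A' ≈ k A²` on the centre manifold, with `k
= 4γμc₀/(μ² + l²)`; hence the quadratic rate in the criterion. There `V = A - M (u² + v²)`, where
`u, v` are the deviations of `(a, b)` from the tangent line `a = a₁ A`, `b = b₁ A`. Contraction of
`(u, v)` at rate `μ` contributes `2Mμ(u² + v²)` to `V'`, which for large `M` absorbs the cross term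
`-2γuA`; the rest is cubic (`mul_sq_le_of_perturbed_posDef`).

The slopes `a₁, b₁` are those of (iv): they solve the linear system, of determinant `μ² + l²`, that
kills the first-order part of the residual. -/

/-! ### Continuation of solutions and the instability criterion -/

/-- A solution on `[0, T]` and one on `[0, S]` that starts where the first one ends can be
concatenated to a solution on `[0, T + S]`. -/
theorem IsSolutionOn.concat {E : Type*} [NormedAddCommGroup E] [NormedSpace ℝ E]
    {F : E → E} {x y : ℝ → E} {T S : ℝ} (hT : 0 ≤ T) (hS : 0 ≤ S)
    (hx : IsSolutionOn F x T) (hy : IsSolutionOn F y S) (hxy : y 0 = x T) :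
    IsSolutionOn F (fun t => if t ≤ T then x t else y (t - T)) (T + S) := by
  set z : ℝ → E := fun t => if t ≤ T then x t else y (t - T) with hz
  have hz₁ : ∀ t ∈ Icc 0 T, z t = x t := fun t ht => if_pos ht.2
  have hz₂ : ∀ t ∈ Icc T (T + S), z t = y (t - T) := by
    intro t ht
    rcases ht.1.eq_or_lt with h | h
    · subst h
      simp [hz, hxy]
    · exact if_neg (not_le.mpr h)
  have hd₁ : ∀ t ∈ Icc 0 T, HasDerivWithinAt z (F (z t)) (Icc 0 T) t := by
    intro t ht
    rw [hz₁ t ht]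
    exact (hx t ht).congr hz₁ (hz₁ t ht)
  have hd₂ : ∀ t ∈ Icc T (T + S), HasDerivWithinAt z (F (z t)) (Icc T (T + S)) t := by
    intro t ht
    rw [hz₂ t ht]
    have hmem : t - T ∈ Icc 0 S := ⟨by linarith [ht.1], by linarith [ht.2]⟩
    have hmaps : MapsTo (fun t => t - T) (Icc T (T + S)) (Icc 0 S) :=
      fun s hs => ⟨by linarith [hs.1], by linarith [hs.2]⟩
    have := (hy (t - T) hmem).scomp t ((hasDerivWithinAt_id t (Icc T (T + S))).sub_const T) hmaps
    rw [one_smul] at this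
    exact this.congr hz₂ (hz₂ t ht)
  intro t ht
  rcases lt_trichotomy t T with h | h | h
  · exact (hd₁ t ⟨ht.1, h.le⟩).mono_of_mem_nhdsWithin
      (mem_nhdsWithin.mpr ⟨Iio T, isOpen_Iio, h, fun s hs => ⟨hs.2.1, (mem_Iio.mp hs.1).le⟩⟩)
  · subst h
    rw [← Icc_union_Icc_eq_Icc hT (le_add_of_nonneg_right hS)]
    exact (hd₁ t (right_mem_Icc.mpr hT)).union
      (hd₂ t (left_mem_Icc.mpr (le_add_of_nonneg_right hS)))
  · exact (hd₂ t ⟨h.le, ht.2⟩).mono_of_mem_nhdsWithin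
      (mem_nhdsWithin.mpr ⟨Ioi T, isOpen_Ioi, h, fun s hs => ⟨(mem_Ioi.mp hs.1).le, hs.2.2⟩⟩)

/-- Near a stable point of a `C¹` vector field, solutions starting close to the point exist on
arbitrarily long time intervals. -/
theorem IsLyapunovStable.exists_isSolutionOn {E : Type*} [NormedAddCommGroup E] [NormedSpace ℝ E]
    [CompleteSpace E] {F : E → E} {p : E} (hF : ContDiffAt ℝ 1 F p) (hp : IsLyapunovStable F p)
    {r : ℝ} (hr : 0 < r) :
    ∃ δ > 0, ∀ x₀, ‖x₀ - p‖ < δ → ∀ T : ℝ, 0 < T → ∃ x : ℝ → E, x 0 = x₀ ∧ IsSolutionOn F x T ∧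
      ∀ t ∈ Icc 0 T, ‖x t - p‖ < r := by
  obtain ⟨ρ, hρ, τ, hτ, hloc⟩ :=
    hF.exists_forall_mem_closedBall_exists_eq_forall_mem_Ioo_hasDerivAt 0
  -- Halving `τ` puts a closed time interval inside the open one given by local existence; the step
  -- length is uniform in `y`.
  have hstep : ∀ y, ‖y - p‖ < ρ → ∃ x : ℝ → E, x 0 = y ∧ IsSolutionOn F x (τ / 2) := by
    intro y hy
    obtain ⟨x, hx₀, hx⟩ := hloc y (mem_closedBall_iff_norm.mpr hy.le)
    exact ⟨x, hx₀, fun t ht =>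
      (hx t ⟨by linarith [ht.1], by linarith [ht.2]⟩).hasDerivWithinAt⟩
  -- Staying within `ρ` of `p` allows a restart at every end point.
  obtain ⟨δ, hδ, hst⟩ := hp (min r ρ) (lt_min hr hρ)
  refine ⟨min δ ρ, lt_min hδ hρ, fun x₀ hx₀ T hT => ?_⟩
  have hex : ∀ n : ℕ, ∃ x : ℝ → E, x 0 = x₀ ∧ IsSolutionOn F x ((n + 1) * (τ / 2)) := by
    intro n
    induction n with
    | zero => simpa using hstep x₀ (hx₀.trans_le (min_le_right _ _))
    | succ n ih =>
      obtain ⟨x, hx, hsol⟩ := ih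
      have hpos : 0 < ((n : ℝ) + 1) * (τ / 2) := by positivity
      have hend := hst _ x hpos hsol (hx ▸ hx₀.trans_le (min_le_left _ _)) _
        (right_mem_Icc.mpr hpos.le)
      obtain ⟨y, hy, hysol⟩ := hstep _ (hend.trans_le (min_le_right _ _))
      refine ⟨_, ?_, (by push_cast; ring : ((n : ℝ) + 1) * (τ / 2) + τ / 2 =
        (((n + 1 : ℕ) : ℝ) + 1) * (τ / 2)) ▸ hsol.concat hpos.le (by positivity) hysol hy⟩
      simp [hpos.le, hx]
  obtain ⟨n, hn⟩ := exists_nat_gt (T / (τ / 2))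
  obtain ⟨x, hx, hsol⟩ := hex n
  have hTn : T ≤ (n + 1) * (τ / 2) := by
    rw [div_lt_iff₀ (by positivity)] at hn
    nlinarith
  have hsolT : IsSolutionOn F x T := fun t ht =>
    (hsol t ⟨ht.1, ht.2.trans hTn⟩).mono (Icc_subset_Icc_right hTn)
  exact ⟨x, hx, hsolT, fun t ht => (hst T x hT hsolT
    (hx ▸ hx₀.trans_le (min_le_left _ _)) t ht).trans_le (min_le_left _ _)⟩

/-- An instability criterion of Chetaev type: if a function `V` that takes positive values
arbitrarily close to `p` satisfies `V' ≥ κ V²` along the flow near `p`, then `p` is not stable. -/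
theorem not_isLyapunovStable_of_mul_sq_le {E : Type*} [NormedAddCommGroup E] [NormedSpace ℝ E]
    [CompleteSpace E] {F : E → E} {p : E} (hF : ContDiffAt ℝ 1 F p)
    {V : E → ℝ} {V' : E → E →L[ℝ] ℝ} {κ : ℝ} (hκ : 0 < κ) (hV : ∀ x, HasFDerivAt V (V' x) x)
    (hVF : ∀ᶠ x in 𝓝 p, κ * V x ^ 2 ≤ V' x (F x)) (hpos : ∃ᶠ x in 𝓝 p, 0 < V x) :
    ¬ IsLyapunovStable F p := by
  intro hp
  have hbdd : ∀ᶠ x in 𝓝 p, V x < V p + 1 :=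
    (hV p).continuousAt.eventually_lt_const (lt_add_one _)
  obtain ⟨r, hr, hball⟩ := Metric.eventually_nhds_iff.mp (hVF.and hbdd)
  obtain ⟨δ, hδ, hsol⟩ := hp.exists_isSolutionOn hF hr
  obtain ⟨x₀, hx₀V, hx₀⟩ := (hpos.and_eventually (Metric.ball_mem_nhds p hδ)).exists
  replace hx₀ : ‖x₀ - p‖ < δ := by rwa [← dist_eq_norm]
  set c := κ * V x₀ ^ 2 with hc
  have hcpos : 0 < c := by positivity
  -- In this time, growth at rate `c` adds `|V p| + 1` to `V x₀ > 0`, overshooting the bound `V p +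
  -- 1`.
  have hT : 0 < (|V p| + 1) / c := by positivity
  obtain ⟨x, hx0, hx, hxr⟩ := hsol x₀ hx₀ _ hT
  set T := (|V p| + 1) / c with hTdef
  have hin : ∀ t ∈ Icc 0 T, κ * V (x t) ^ 2 ≤ V' (x t) (F (x t)) ∧ V (x t) < V p + 1 :=
    fun t ht => hball (by rw [dist_eq_norm]; exact hxr t ht)
  have hcont : ContinuousOn (fun t => V (x t)) (Icc 0 T) := fun t ht =>
    ((hV (x t)).comp_hasDerivWithinAt t (hx t ht)).continuousWithinAt
  have hderiv : ∀ t ∈ interior (Icc 0 T),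
      HasDerivAt (fun t => V (x t)) (V' (x t) (F (x t))) t := fun t ht =>
    ((hV (x t)).comp_hasDerivWithinAt t (hx t (interior_subset ht))).hasDerivAt
      (mem_interior_iff_mem_nhds.mp ht)
  have hmono : MonotoneOn (fun t => V (x t)) (Icc 0 T) := by
    refine monotoneOn_of_deriv_nonneg (convex_Icc _ _) hcont
      (fun t ht => (hderiv t ht).differentiableAt.differentiableWithinAt) fun t ht => ?_
    rw [(hderiv t ht).deriv]
    exact le_trans (by positivity) (hin t (interior_subset ht)).1
  have h0 : (0 : ℝ) ∈ Icc 0 T := left_mem_Icc.mpr hT.le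
  have hT' : T ∈ Icc 0 T := right_mem_Icc.mpr hT.le
  have hgrow := (convex_Icc 0 T).mul_sub_le_image_sub_of_le_deriv hcont
    (fun t ht => (hderiv t ht).differentiableAt.differentiableWithinAt) (C := c)
    (fun t ht => by
      rw [(hderiv t ht).deriv]
      have ht' := interior_subset ht
      refine le_trans ?_ (hin t ht').1
      have : V x₀ ≤ V (x t) := by simpa [hx0] using hmono h0 ht' ht'.1
      rw [hc]
      gcongr) 0 h0 T hT' hT.le
  have hcT : c * (T - 0) = |V p| + 1 := by rw [hTdef]; field_simp; ring
  rw [hcT, hx0] at hgrow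
  linarith [(hin T hT').2, le_abs_self (V p)]

/-! ### Equilibria and instability at `(-μ, l, 0)` -/

theorem contDiff_vortexField (γ l μ c₀ : ℝ) : ContDiff ℝ 1 (vortexField γ l μ c₀) := by
  unfold vortexField
  fun_prop

theorem isEquilibrium_vortexField_iff {γ l μ c₀ : ℝ} (hγ : γ ≠ 0) (hμ : μ ≠ 0) (hc₀ : c₀ ≠ 0)
    (p : ℝ × ℝ × ℝ) :
    IsEquilibrium (vortexField γ l μ c₀) p ↔ p = (0, 0, 0) ∨ p = (-μ, l, 0) := by
  obtain ⟨a, b, A⟩ := p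
  simp only [IsEquilibrium, vortexField, Prod.mk_eq_zero, Prod.mk.injEq]
  constructor
  · rintro ⟨h₁, h₂, h₃⟩
    by_cases ha : a = 0
    · subst ha
      have hb : b = 0 := by
        have : μ * b = 0 := by linarith
        exact (mul_eq_zero.mp this).resolve_left hμ
      subst hb
      have hA : c₀ * A = 0 := by linarith
      exact Or.inl ⟨rfl, rfl, (mul_eq_zero.mp hA).resolve_left hc₀⟩
    · have hA : A = 0 := by
        rcases mul_eq_zero.mp h₃ with h | h
        · rcases mul_eq_zero.mp h with h | h
          · exact absurd (by linarith) hγ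
          · exact absurd h ha
        · exact h
      subst hA
      -- with `z = a + b i` the remaining equations read `z (z + μ - l i) = 0`
      have hsum : (a ^ 2 + b ^ 2) * ((a + μ) ^ 2 + (b - l) ^ 2) = 0 := by
        linear_combination
          (-a ^ 2 + b ^ 2 - l * b - μ * a) * h₁ + (-2 * a * b + l * a - μ * b) * h₂
      have hne : a ^ 2 + b ^ 2 ≠ 0 := by positivity
      have h := (mul_eq_zero.mp hsum).resolve_left hne
      refine Or.inr ⟨?_, ?_, rfl⟩ <;> nlinarith [sq_nonneg (a + μ), sq_nonneg (b - l)]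
  · rintro (⟨rfl, rfl, rfl⟩ | ⟨rfl, rfl, rfl⟩) <;> refine ⟨?_, ?_, ?_⟩ <;> ring

/-- Where `a < -μ/2` and `A² < 1`, `(A²)' = -4γaA² ≥ 2γμA² ≥ 2γμA⁴`. -/
theorem not_isLyapunovStable_vortexField_neg {γ l μ c₀ : ℝ} (hγ : 0 < γ) (hμ : 0 < μ) :
    ¬ IsLyapunovStable (vortexField γ l μ c₀) (-μ, l, 0) := by
  have hV : ∀ p : ℝ × ℝ × ℝ, HasFDerivAt (fun p : ℝ × ℝ × ℝ => p.2.2 ^ 2)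
      ((2 * p.2.2) • (ContinuousLinearMap.snd ℝ ℝ ℝ).comp (ContinuousLinearMap.snd ℝ ℝ (ℝ × ℝ)))
      p := by
    intro p
    have h : HasFDerivAt (fun p : ℝ × ℝ × ℝ => p.2.2) ((ContinuousLinearMap.snd ℝ ℝ ℝ).comp
      (ContinuousLinearMap.snd ℝ ℝ (ℝ × ℝ))) p := hasFDerivAt_snd.comp p hasFDerivAt_snd
    simpa using h.pow 2
  refine not_isLyapunovStable_of_mul_sq_le (contDiff_vortexField γ l μ c₀).contDiffAt
    (κ := 2 * γ * μ) (by positivity) hV ?_ ?_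
  · have h₁ : ∀ᶠ p : ℝ × ℝ × ℝ in 𝓝 (-μ, l, 0), p.1 < -μ / 2 :=
      continuous_fst.continuousAt.eventually_lt_const (show -μ < -μ / 2 by linarith)
    have h₂ : ∀ᶠ p : ℝ × ℝ × ℝ in 𝓝 (-μ, l, 0), p.2.2 ^ 2 < 1 :=
      Tendsto.eventually_lt_const (show (0 : ℝ) ^ 2 < 1 by simp)
        (Continuous.tendsto (by fun_prop) ((-μ, l, 0) : ℝ × ℝ × ℝ))
    filter_upwards [h₁, h₂] with p hp₁ hp₂
    simp only [vortexField, smul_apply, ContinuousLinearMap.comp_apply,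
      ContinuousLinearMap.coe_snd', smul_eq_mul]
    have h₃ : (p.2.2 ^ 2) ^ 2 ≤ p.2.2 ^ 2 := by nlinarith [sq_nonneg p.2.2]
    have h₄ : 0 ≤ γ * p.2.2 ^ 2 * (-μ / 2 - p.1) := by
      have : 0 ≤ -μ / 2 - p.1 := by linarith
      positivity
    have h₅ := mul_le_mul_of_nonneg_left h₃ (by positivity : 0 ≤ 2 * γ * μ)
    linarith
  · have ht : Tendsto (fun s : ℝ => ((-μ, l, s) : ℝ × ℝ × ℝ)) (𝓝[≠] 0) (𝓝 (-μ, l, 0)) :=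
      (Continuous.tendsto (by fun_prop) 0).mono_left nhdsWithin_le_nhds
    refine ht.frequently (Eventually.frequently ?_)
    filter_upwards [self_mem_nhdsWithin] with s hs
    exact sq_pos_of_ne_zero hs

/-! ### Instability at the origin -/

/-- A positive definite quadratic form in `A` and the deviations `a - a₁ A`, `b - b₁ A` dominates
the cubic terms that the vortex system adds to it near the origin. -/
theorem mul_sq_le_of_perturbed_posDef {γ μ k M m a₁ b₁ : ℝ} (hγ : 0 ≤ γ) (hk : 0 < k) (hM : 0 < M)
    (hm : 0 < m) (hMμ : M * μ * k = 4 * γ ^ 2 + k) (hmk : 4 * m ≤ k) (hmM : 2 * m ≤ M * μ)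
    (a b A : ℝ)
    (hcub : (4 + 2 * a₁ ^ 2 + 2 * b₁ ^ 2) * (2 + 2 * γ * |a₁| + 2 * γ * |b₁|) *
      (2 * M * (|a - a₁ * A| + |b - b₁ * A|)) < m)
    (hone : (a - a₁ * A) ^ 2 + (b - b₁ * A) ^ 2 < 1) :
    m / (2 + 2 * M ^ 2) * (A - M * ((a - a₁ * A) ^ 2 + (b - b₁ * A) ^ 2)) ^ 2 ≤
      k * A ^ 2 - 2 * γ * (a - a₁ * A) * A +
        2 * M * μ * ((a - a₁ * A) ^ 2 + (b - b₁ * A) ^ 2) -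
        2 * M * ((a - a₁ * A) * (b ^ 2 - a ^ 2 + 2 * γ * a₁ * a * A) +
          (b - b₁ * A) * (-2 * a * b + 2 * γ * b₁ * a * A)) := by
  obtain ⟨u, hu⟩ : ∃ u, u = a - a₁ * A := ⟨_, rfl⟩
  obtain ⟨v, hv⟩ : ∃ v, v = b - b₁ * A := ⟨_, rfl⟩
  obtain ⟨P, hP⟩ : ∃ P, P = 4 + 2 * a₁ ^ 2 + 2 * b₁ ^ 2 := ⟨_, rfl⟩
  obtain ⟨N, hN⟩ : ∃ N, N = A ^ 2 + u ^ 2 + v ^ 2 := ⟨_, rfl⟩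
  have hN0 : 0 ≤ N := by rw [hN]; positivity
  have ha : a = u + a₁ * A := by rw [hu]; ring
  have hb : b = v + b₁ * A := by rw [hv]; ring
  rw [← hu, ← hv, ← hP] at hcub
  rw [← hu, ← hv] at hone ⊢
  obtain ⟨K, hK⟩ : ∃ K, K = P * (2 + 2 * γ * |a₁| + 2 * γ * |b₁|) := ⟨_, rfl⟩
  rw [← hK] at hcub
  have hP0 : 0 ≤ P := by rw [hP]; positivity
  have hPN : a ^ 2 + b ^ 2 + A ^ 2 ≤ P * N := by
    have e : P * N - (a ^ 2 + b ^ 2 + A ^ 2) = (u - a₁ * A) ^ 2 + (v - b₁ * A) ^ 2 + 3 * A ^ 2 +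
        (2 + 2 * a₁ ^ 2 + 2 * b₁ ^ 2) * (u ^ 2 + v ^ 2) := by
      rw [hP, hN, ha, hb]; ring
    have : 0 ≤ (u - a₁ * A) ^ 2 + (v - b₁ * A) ^ 2 + 3 * A ^ 2 +
        (2 + 2 * a₁ ^ 2 + 2 * b₁ ^ 2) * (u ^ 2 + v ^ 2) := by positivity
    linarith
  have haA : |a * A| ≤ P * N := by
    rw [abs_le]
    constructor <;> linarith [sq_nonneg (a + A), sq_nonneg (a - A), sq_nonneg b, sq_nonneg a]
  have hmix : ∀ c : ℝ, |2 * γ * c * (a * A)| ≤ 2 * γ * |c| * (P * N) := fun c => by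
    rw [abs_mul, abs_mul, abs_of_nonneg (by positivity : 0 ≤ 2 * γ)]
    gcongr
  have hPN0 : 0 ≤ P * N := mul_nonneg hP0 hN0
  have hg₁ : 0 ≤ 2 * γ * |a₁| * (P * N) := by positivity
  have hg₂ : 0 ≤ 2 * γ * |b₁| * (P * N) := by positivity
  have hKN : K * N = 2 * (P * N) + 2 * γ * |a₁| * (P * N) + 2 * γ * |b₁| * (P * N) := by
    rw [hK]; ring
  have hq₁ : |b ^ 2 - a ^ 2 + 2 * γ * a₁ * a * A| ≤ K * N := by
    have h := abs_le.mp (hmix a₁)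
    rw [abs_le]
    constructor <;> linarith [sq_nonneg a, sq_nonneg b, sq_nonneg A]
  have hq₂ : |-2 * a * b + 2 * γ * b₁ * a * A| ≤ K * N := by
    have h := abs_le.mp (hmix b₁)
    rw [abs_le]
    constructor <;> linarith [sq_nonneg (a + b), sq_nonneg (a - b), sq_nonneg A]
  -- Both quadratic factors are at most `K N`, and `hcub` makes the linear factor `|u| + |v|` small
  -- enough.
  have hcubic : 2 * M * (u * (b ^ 2 - a ^ 2 + 2 * γ * a₁ * a * A) +
      v * (-2 * a * b + 2 * γ * b₁ * a * A)) ≤ m * N := by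
    have h₁ : u * (b ^ 2 - a ^ 2 + 2 * γ * a₁ * a * A) ≤ |u| * (K * N) :=
      (le_abs_self _).trans (by rw [abs_mul]; gcongr)
    have h₂ : v * (-2 * a * b + 2 * γ * b₁ * a * A) ≤ |v| * (K * N) :=
      (le_abs_self _).trans (by rw [abs_mul]; gcongr)
    have h₃ := mul_le_mul_of_nonneg_left (add_le_add h₁ h₂) (by positivity : 0 ≤ 2 * M)
    have h₄ := mul_le_mul_of_nonneg_right hcub.le hN0
    linarith
  have hcross : 0 ≤ k / 4 * A ^ 2 - 2 * γ * u * A + M * μ * u ^ 2 := by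
    -- The value of `M` in `hMμ` is what completes this square.
    have e : k * (k / 4 * A ^ 2 - 2 * γ * u * A + M * μ * u ^ 2) =
        (k / 2 * A - 2 * γ * u) ^ 2 + k * u ^ 2 := by
      linear_combination u ^ 2 * hMμ
    exact nonneg_of_mul_nonneg_right (e ▸ by positivity) hk
  have hV : (A - M * (u ^ 2 + v ^ 2)) ^ 2 ≤ (2 + 2 * M ^ 2) * N := by
    have h₁ : (u ^ 2 + v ^ 2) ^ 2 ≤ u ^ 2 + v ^ 2 := by nlinarith [sq_nonneg u, sq_nonneg v]
    have h₂ := mul_le_mul_of_nonneg_left h₁ (by positivity : 0 ≤ 2 * M ^ 2)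
    have h₃ : 0 ≤ 2 * (u ^ 2 + v ^ 2) + 2 * M ^ 2 * A ^ 2 := by positivity
    rw [hN]
    linarith [sq_nonneg (A + M * (u ^ 2 + v ^ 2))]
  have hlow : m / (2 + 2 * M ^ 2) * (A - M * (u ^ 2 + v ^ 2)) ^ 2 ≤ m * N := by
    refine (mul_le_mul_of_nonneg_left hV (by positivity)).trans_eq ?_
    field_simp
  -- The term `m N` is spent twice, on the cubic terms and on `κ V²`. After `hcross`, at least
  -- `3k/4` of `A²` and `Mμ` of `u² + v²` remain to pay for it.
  have h₁ := mul_le_mul_of_nonneg_right hmk (sq_nonneg A)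
  have h₂ := mul_le_mul_of_nonneg_right hmM (add_nonneg (sq_nonneg u) (sq_nonneg v))
  have h₃ : m * N = m * A ^ 2 + m * (u ^ 2 + v ^ 2) := by rw [hN]; ring
  have h₄ : 0 ≤ M * μ * v ^ 2 := mul_nonneg (by linarith) (sq_nonneg v)
  have h₅ : 0 ≤ k * A ^ 2 := by positivity
  linarith

theorem not_isLyapunovStable_vortexField_zero {γ l μ c₀ : ℝ} (hγ : 0 < γ) (hμ : 0 < μ)
    (hc₀ : 0 < c₀) : ¬ IsLyapunovStable (vortexField γ l μ c₀) (0, 0, 0) := by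
  have hD : 0 < μ ^ 2 + l ^ 2 := by positivity
  obtain ⟨a₁, ha₁⟩ : ∃ a₁, a₁ = -(2 * μ * c₀) / (μ ^ 2 + l ^ 2) := ⟨_, rfl⟩
  obtain ⟨b₁, hb₁⟩ : ∃ b₁, b₁ = -(2 * l * c₀) / (μ ^ 2 + l ^ 2) := ⟨_, rfl⟩
  have ha₁neg : a₁ < 0 := by
    rw [ha₁]; exact div_neg_of_neg_of_pos (by linarith [mul_pos hμ hc₀]) hD
  have he₁ : μ * a₁ + l * b₁ + 2 * c₀ = 0 := by rw [ha₁, hb₁]; field_simp; ring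
  have he₂ : l * a₁ - μ * b₁ = 0 := by rw [ha₁, hb₁]; field_simp; ring
  obtain ⟨k, hk⟩ : ∃ k, k = -2 * γ * a₁ := ⟨_, rfl⟩
  have hkpos : 0 < k := by rw [hk]; nlinarith [mul_pos hγ (neg_pos.mpr ha₁neg)]
  obtain ⟨M, hM⟩ : ∃ M, M = (4 * γ ^ 2 / k + 1) / μ := ⟨_, rfl⟩
  have hMpos : 0 < M := by rw [hM]; positivity
  have hMμ : M * μ * k = 4 * γ ^ 2 + k := by rw [hM]; field_simp
  -- the deviation of `(a, b)` from the linear approximation of the centre manifold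
  let X : ℝ × ℝ × ℝ →L[ℝ] ℝ := ContinuousLinearMap.fst ℝ ℝ (ℝ × ℝ)
  let Y : ℝ × ℝ × ℝ →L[ℝ] ℝ :=
    (ContinuousLinearMap.fst ℝ ℝ ℝ).comp (ContinuousLinearMap.snd ℝ ℝ (ℝ × ℝ))
  let Z : ℝ × ℝ × ℝ →L[ℝ] ℝ :=
    (ContinuousLinearMap.snd ℝ ℝ ℝ).comp (ContinuousLinearMap.snd ℝ ℝ (ℝ × ℝ))
  let u : ℝ × ℝ × ℝ →L[ℝ] ℝ := X - a₁ • Z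
  let v : ℝ × ℝ × ℝ →L[ℝ] ℝ := Y - b₁ • Z
  have hV : ∀ p : ℝ × ℝ × ℝ, HasFDerivAt (fun p => Z p - M * (u p ^ 2 + v p ^ 2))
      (Z - M • ((2 * u p) • u + (2 * v p) • v)) p := by
    intro p
    have h : HasFDerivAt (fun p => Z p - M * (u p ^ 2 + v p ^ 2)) _ p := Z.hasFDerivAt.sub
      (((u.hasFDerivAt (x := p).pow 2).add (v.hasFDerivAt (x := p).pow 2)).const_mul M)
    simpa using h
  obtain ⟨m, hm⟩ : ∃ m, m = min (k / 4) (M * μ / 2) := ⟨_, rfl⟩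
  have hmpos : 0 < m := by rw [hm]; positivity
  obtain ⟨K, hK⟩ : ∃ K, K = (4 + 2 * a₁ ^ 2 + 2 * b₁ ^ 2) * (2 + 2 * γ * |a₁| + 2 * γ * |b₁|) :=
    ⟨_, rfl⟩
  have hKpos : 0 < K := by rw [hK]; positivity
  refine not_isLyapunovStable_of_mul_sq_le (contDiff_vortexField γ l μ c₀).contDiffAt
    (κ := m / (2 + 2 * M ^ 2)) (by positivity) hV ?_ ?_
  · have h₁ : ∀ᶠ p : ℝ × ℝ × ℝ in 𝓝 (0, 0, 0), 2 * M * K * (|u p| + |v p|) < m :=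
      Tendsto.eventually_lt_const (v := 2 * M * K * (|u (0, 0, 0)| + |v (0, 0, 0)|))
        (by simpa [u, v, X, Y, Z] using hmpos) (Continuous.tendsto (by fun_prop) _)
    have h₂ : ∀ᶠ p : ℝ × ℝ × ℝ in 𝓝 (0, 0, 0), u p ^ 2 + v p ^ 2 < 1 :=
      Tendsto.eventually_lt_const (v := u (0, 0, 0) ^ 2 + v (0, 0, 0) ^ 2)
        (by simp [u, v, X, Y, Z]) (Continuous.tendsto (by fun_prop) _)
    filter_upwards [h₁, h₂] with p hp₁ hp₂
    obtain ⟨a, b, A⟩ := p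
    have hu : u (a, b, A) = a - a₁ * A := by simp [u, X, Z]
    have hv : v (a, b, A) = b - b₁ * A := by simp [v, Y, Z]
    have hK' : K * (2 * M * (|a - a₁ * A| + |b - b₁ * A|)) < m := by
      rw [hu, hv] at hp₁
      linarith
    rw [hu, hv] at hp₂
    have h := mul_sq_le_of_perturbed_posDef (γ := γ) (μ := μ) (m := m) (k := k) (M := M) (a₁ := a₁)
      (b₁ := b₁) hγ.le hkpos hMpos hmpos hMμ (by rw [hm]; linarith [min_le_left (k / 4) (M * μ / 2)])
      (by rw [hm]; linarith [min_le_right (k / 4) (M * μ / 2)]) a b A (hK ▸ hK') hp₂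
    have hval : (Z - M • ((2 * u (a, b, A)) • u + (2 * v (a, b, A)) • v))
        (vortexField γ l μ c₀ (a, b, A)) =
        k * A ^ 2 - 2 * γ * (a - a₁ * A) * A +
          2 * M * μ * ((a - a₁ * A) ^ 2 + (b - b₁ * A) ^ 2) -
          2 * M * ((a - a₁ * A) * (b ^ 2 - a ^ 2 + 2 * γ * a₁ * a * A) +
            (b - b₁ * A) * (-2 * a * b + 2 * γ * b₁ * a * A)) := by
      rw [hu, hv]
      simp only [u, v, X, Y, Z, vortexField, sub_apply, add_apply,
        smul_apply, ContinuousLinearMap.comp_apply,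
        ContinuousLinearMap.coe_snd', ContinuousLinearMap.coe_fst', smul_eq_mul]
      rw [hk]
      -- The slope equations remove the terms linear in `A` from `u'` and `v'`; the rotation terms
      -- `-lv` and `lu` cancel in `uu' + vv'`.
      linear_combination (2 * M * A * (a - a₁ * A)) * he₁ - (2 * M * A * (b - b₁ * A)) * he₂
    rw [hval]
    have hZ : Z (a, b, A) = A := rfl
    rw [hZ, hu, hv]
    exact h
  -- On the tangent line `u = v = 0`, so `V = s > 0`.
  · have ht : Tendsto (fun s : ℝ => ((a₁ * s, b₁ * s, s) : ℝ × ℝ × ℝ)) (𝓝[>] 0)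
        (𝓝 (0, 0, 0)) := by
      have : Continuous fun s : ℝ => ((a₁ * s, b₁ * s, s) : ℝ × ℝ × ℝ) := by fun_prop
      simpa using (this.tendsto 0).mono_left nhdsWithin_le_nhds
    refine ht.frequently (Eventually.frequently ?_)
    filter_upwards [self_mem_nhdsWithin] with s hs
    simpa [u, v, X, Y, Z] using hs

/-! ### Spectrum of the linearization -/

theorem roots_prod_X_sub_C_three {R : Type*} [CommRing R] [IsDomain R] (x y z : R) :
    ((Polynomial.X - Polynomial.C x) * ((Polynomial.X - Polynomial.C y) *
      (Polynomial.X - Polynomial.C z))).roots = {x, y, z} := by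
  have h := Polynomial.roots_multiset_prod_X_sub_C ({x, y, z} : Multiset R)
  simpa using h

/-- The basis of `R × R × R` with coordinates `(p.1, p.2.1, p.2.2)`. -/
noncomputable def Module.Basis.finThreeProd (R : Type*) [Semiring R] :
    Module.Basis (Fin 3) R (R × R × R) :=
  .ofEquivFun
    { toFun := fun p => ![p.1, p.2.1, p.2.2]
      invFun := fun f => (f 0, f 1, f 2)
      map_add' := fun p q => by ext i; fin_cases i <;> rfl
      map_smul' := fun c p => by ext i; fin_cases i <;> rfl
      left_inv := fun p => rfl
      right_inv := fun f => by ext i; fin_cases i <;> rfl }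

theorem Module.Basis.finThreeProd_repr {R : Type*} [Semiring R] (p : R × R × R) :
    ⇑((Module.Basis.finThreeProd R).repr p) = ![p.1, p.2.1, p.2.2] := rfl

theorem Module.Basis.finThreeProd_apply {R : Type*} [Semiring R] (i : Fin 3) :
    Module.Basis.finThreeProd R i = ![(1, 0, 0), (0, 1, 0), (0, 0, 1)] i := by
  apply (Module.Basis.finThreeProd R).repr.injective
  ext j
  rw [Module.Basis.repr_self, Module.Basis.finThreeProd_repr]
  fin_cases i <;> fin_cases j <;> simp

/-- The derivative of `vortexField` at `(a, b, A)`. -/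
theorem fderiv_vortexField_apply (γ l μ c₀ a b A : ℝ) (q : ℝ × ℝ × ℝ) :
    fderiv ℝ (vortexField γ l μ c₀) (a, b, A) q =
      ((-2 * a - μ) * q.1 + (2 * b - l) * q.2.1 - 2 * c₀ * q.2.2,
        (l - 2 * b) * q.1 + (-2 * a - μ) * q.2.1,
        -2 * γ * A * q.1 - 2 * γ * a * q.2.2) := by
  have hX : HasFDerivAt (fun p : ℝ × ℝ × ℝ => p.1) (ContinuousLinearMap.fst ℝ ℝ (ℝ × ℝ))
    (a, b, A) := hasFDerivAt_fst
  have hY : HasFDerivAt (fun p : ℝ × ℝ × ℝ => p.2.1) ((ContinuousLinearMap.fst ℝ ℝ ℝ).comp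
    (ContinuousLinearMap.snd ℝ ℝ (ℝ × ℝ))) (a, b, A) := hasFDerivAt_fst.comp _ hasFDerivAt_snd
  have hZ : HasFDerivAt (fun p : ℝ × ℝ × ℝ => p.2.2) ((ContinuousLinearMap.snd ℝ ℝ ℝ).comp
    (ContinuousLinearMap.snd ℝ ℝ (ℝ × ℝ))) (a, b, A) := hasFDerivAt_snd.comp _ hasFDerivAt_snd
  have h₁ := ((((hX.pow 2).neg.add (hY.pow 2)).sub (hY.const_mul l)).sub
    (hZ.const_mul (2 * c₀))).sub (hX.const_mul μ)
  have h₂ := (((hX.const_mul (-2)).mul hY).add (hX.const_mul l)).sub (hY.const_mul μ)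
  have h₃ := (hX.const_mul (-2 * γ)).mul hZ
  have h : HasFDerivAt (vortexField γ l μ c₀) _ (a, b, A) := h₁.prodMk (h₂.prodMk h₃)
  rw [h.fderiv]
  ext <;> simp <;> ring

/-- At `A = 0` the Jacobian is block triangular: the entry `-2γa`, and a scaled rotation block with
eigenvalues `(-2a - μ) ± (l - 2b)i`. -/
theorem linearizationEigenvalues_vortexField (γ l μ c₀ a b : ℝ) :
    linearizationEigenvalues (vortexField γ l μ c₀) (a, b, 0) =
      {((-2 * γ * a : ℝ) : ℂ), ((-2 * a - μ : ℝ) : ℂ) + ((l - 2 * b : ℝ) : ℂ) * Complex.I,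
        ((-2 * a - μ : ℝ) : ℂ) - ((l - 2 * b : ℝ) : ℂ) * Complex.I} := by
  rw [linearizationEigenvalues, Polynomial.aroots,
    ← LinearMap.charpoly_toMatrix _ (Module.Basis.finThreeProd ℝ)]
  have hM : LinearMap.toMatrix (Module.Basis.finThreeProd ℝ) (Module.Basis.finThreeProd ℝ)
      ((fderiv ℝ (vortexField γ l μ c₀) (a, b, 0) : ℝ × ℝ × ℝ →L[ℝ] ℝ × ℝ × ℝ) :
        ℝ × ℝ × ℝ →ₗ[ℝ] ℝ × ℝ × ℝ) =
      !![-2 * a - μ, 2 * b - l, -2 * c₀; l - 2 * b, -2 * a - μ, 0; 0, 0, -2 * γ * a] := by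
    ext i j
    fin_cases i <;> fin_cases j <;>
      simp [LinearMap.toMatrix_apply, Module.Basis.finThreeProd_repr,
        Module.Basis.finThreeProd_apply, fderiv_vortexField_apply]
  rw [hM, ← roots_prod_X_sub_C_three]
  congr 1
  rw [← Matrix.charpoly_map, Matrix.charpoly, Matrix.det_fin_three]
  simp [Matrix.charmatrix]
  have hI : (Polynomial.C Complex.I : Polynomial ℂ) ^ 2 = -1 := by
    rw [← Polynomial.C_pow, Complex.I_sq]; simp
  ring_nf
  simp [hI]
  ring

/-! ### Second-order invariance and the reduced equation -/

theorem ContDiffAt.differentiableAt_deriv_of_two {f : ℝ → ℝ} {x : ℝ} (hf : ContDiffAt ℝ 2 f x) :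
    DifferentiableAt ℝ (deriv f) x := by
  have h : ContDiffAt ℝ 1 (fderiv ℝ f) x := hf.fderiv_right (by norm_num)
  exact (h.differentiableAt one_ne_zero).clm_apply (differentiableAt_const 1)

/-- First-order Taylor expansion with quadratic remainder. -/
theorem ContDiffAt.sub_deriv_mul_isBigO_sq {f : ℝ → ℝ} (hf : ContDiffAt ℝ 2 f 0) (h0 : f 0 = 0) :
    (fun A => f A - deriv f 0 * A) =O[𝓝 0] fun A : ℝ => A ^ 2 := by
  have hd : DifferentiableAt ℝ (deriv f) 0 := hf.differentiableAt_deriv_of_two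
  have hdiff : ∀ᶠ x in 𝓝 (0 : ℝ), DifferentiableAt ℝ f x := by
    filter_upwards [hf.eventually (by simp)] with x hx
    exact hx.differentiableAt (by simp)
  obtain ⟨C, hC0, hC⟩ := hd.isBigO_sub.exists_nonneg
  obtain ⟨r, hr, hball⟩ := Metric.eventually_nhds_iff_ball.mp (hC.bound.and hdiff)
  refine IsBigO.of_bound C ?_
  filter_upwards [Metric.ball_mem_nhds 0 hr] with A hA
  have hsub : ∀ x ∈ Metric.closedBall (0 : ℝ) |A|, x ∈ Metric.ball (0 : ℝ) r := by
    intro x hx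
    simp only [Metric.mem_ball, Metric.mem_closedBall, dist_zero_right, Real.norm_eq_abs] at *
    linarith
  -- On the ball of radius `|A|` the remainder has derivative at most `C|A|`, so the mean value
  -- inequality gives `C|A|²`.
  have hmv := (convex_closedBall (0 : ℝ) |A|).norm_image_sub_le_of_norm_hasDerivWithin_le
    (f := fun A => f A - deriv f 0 * A) (f' := fun x => deriv f x - deriv f 0 * 1)
    (C := C * |A|) (x := 0) (y := A)
    (fun x hx => ((hball x (hsub x hx)).2.hasDerivAt.sub
      ((hasDerivAt_id x).const_mul _)).hasDerivWithinAt)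
    (fun x hx => by
      have h := (hball x (hsub x hx)).1
      have hxA : |x| ≤ |A| := by simpa using hx
      simp only [mul_one, sub_zero, Real.norm_eq_abs] at h ⊢
      exact h.trans (by gcongr))
    (by simp) (by simp)
  simpa [h0, pow_two, mul_assoc] using hmv

theorem const_mul_isBigO_sq_iff (c : ℝ) :
    ((fun A : ℝ => c * A) =O[𝓝 0] fun A : ℝ => A ^ 2) ↔ c = 0 := by
  constructor
  · intro h
    by_contra hc
    have h₁ : (fun A : ℝ => A ^ 2) =o[𝓝 0] fun A : ℝ => A := isLittleO_pow_id one_lt_two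
    have h₂ : (fun A : ℝ => A) =o[𝓝 0] fun A : ℝ => A :=
      (isBigO_const_mul_left_iff hc).mp h |>.trans_isLittleO h₁
    refine isLittleO_irrefl (f'' := fun A : ℝ => A) (l := 𝓝 0) ?_ h₂
    exact Frequently.filter_mono (Eventually.frequently (self_mem_nhdsWithin (s := {0}ᶜ)))
      nhdsWithin_le_nhds
  · rintro rfl
    simpa using isBigO_zero _ _

/-- Modulo `O(A²)` each residual component is a constant times `A`, and that constant must vanish.
-/
theorem substitutionResidual_isBigO_iff {γ l μ c₀ : ℝ} (hμ : μ ≠ 0) {α β : ℝ → ℝ}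
    (hα : ContDiffAt ℝ 2 α 0) (hβ : ContDiffAt ℝ 2 β 0) (hα0 : α 0 = 0) (hβ0 : β 0 = 0) :
    (substitutionResidual (vortexField γ l μ c₀) α β =O[𝓝 0] fun A : ℝ => A ^ 2) ↔
      deriv α 0 = -(2 * μ * c₀) / (μ ^ 2 + l ^ 2) ∧
        deriv β 0 = -(2 * l * c₀) / (μ ^ 2 + l ^ 2) := by
  have hTα := hα.sub_deriv_mul_isBigO_sq hα0
  have hTβ := hβ.sub_deriv_mul_isBigO_sq hβ0
  have hOα : α =O[𝓝 0] fun A : ℝ => A := by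
    simpa [hα0] using (hα.differentiableAt (by simp)).isBigO_sub
  have hOβ : β =O[𝓝 0] fun A : ℝ => A := by
    simpa [hβ0] using (hβ.differentiableAt (by simp)).isBigO_sub
  have hid : (fun A : ℝ => A) =O[𝓝 0] fun A : ℝ => A := isBigO_refl _ _
  have hαα : (fun A => α A * α A) =O[𝓝 0] fun A : ℝ => A ^ 2 := by
    simpa only [pow_two] using hOα.mul hOα
  have hββ : (fun A => β A * β A) =O[𝓝 0] fun A : ℝ => A ^ 2 := by
    simpa only [pow_two] using hOβ.mul hOβ
  have hαβ : (fun A => α A * β A) =O[𝓝 0] fun A : ℝ => A ^ 2 := by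
    simpa only [pow_two] using hOα.mul hOβ
  have hαA : (fun A => α A * A) =O[𝓝 0] fun A : ℝ => A ^ 2 := by
    simpa only [pow_two] using hOα.mul hid
  have hdα : (fun A => deriv α A * (α A * A)) =O[𝓝 0] fun A : ℝ => A ^ 2 := by
    simpa using (hα.differentiableAt_deriv_of_two.continuousAt.isBigO_one ℝ).mul hαA
  have hdβ : (fun A => deriv β A * (α A * A)) =O[𝓝 0] fun A : ℝ => A ^ 2 := by
    simpa using (hβ.differentiableAt_deriv_of_two.continuousAt.isBigO_one ℝ).mul hαA
  have hR₁ : (fun A => (substitutionResidual (vortexField γ l μ c₀) α β A).1 -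
      (μ * deriv α 0 + l * deriv β 0 + 2 * c₀) * A) =O[𝓝 0] fun A : ℝ => A ^ 2 := by
    refine (((((hdα.const_mul_left (-2 * γ)).add hαα).sub hββ).add
      (hTβ.const_mul_left l)).add (hTα.const_mul_left μ)).congr_left fun A => ?_
    simp only [substitutionResidual, vortexField]
    ring
  have hR₂ : (fun A => (substitutionResidual (vortexField γ l μ c₀) α β A).2 -
      (μ * deriv β 0 - l * deriv α 0) * A) =O[𝓝 0] fun A : ℝ => A ^ 2 := by
    refine ((((hdβ.const_mul_left (-2 * γ)).add (hαβ.const_mul_left 2)).sub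
      (hTα.const_mul_left l)).add (hTβ.const_mul_left μ)).congr_left fun A => ?_
    simp only [substitutionResidual, vortexField]
    ring
  have hiff : (substitutionResidual (vortexField γ l μ c₀) α β =O[𝓝 0] fun A : ℝ => A ^ 2) ↔
      μ * deriv α 0 + l * deriv β 0 + 2 * c₀ = 0 ∧ μ * deriv β 0 - l * deriv α 0 = 0 := by
    rw [← const_mul_isBigO_sq_iff, ← const_mul_isBigO_sq_iff (μ * deriv β 0 - l * deriv α 0)]
    refine Iff.trans (isBigO_prod_left
      (f' := fun A => (substitutionResidual (vortexField γ l μ c₀) α β A).1)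
      (g' := fun A => (substitutionResidual (vortexField γ l μ c₀) α β A).2)) ?_
    refine and_congr ⟨fun h => ?_, fun h => ?_⟩ ⟨fun h => ?_, fun h => ?_⟩
    · simpa using h.sub hR₁
    · simpa using hR₁.add h
    · simpa using h.sub hR₂
    · simpa using hR₂.add h
  have hD : μ ^ 2 + l ^ 2 ≠ 0 := by positivity
  rw [hiff, eq_div_iff hD, eq_div_iff hD]
  constructor
  · rintro ⟨h₁, h₂⟩
    exact ⟨by linear_combination μ * h₁ - l * h₂, by linear_combination l * h₁ + μ * h₂⟩
  · rintro ⟨h₁, h₂⟩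
    constructor <;> apply mul_right_cancel₀ hD
    · linear_combination μ * h₁ + l * h₂
    · linear_combination μ * h₂ - l * h₁

theorem vortexField_reduced_isBigO {γ l μ c₀ : ℝ} {α β : ℝ → ℝ}
    (hα : ContDiffAt ℝ 2 α 0) (hα0 : α 0 = 0)
    (hα1 : deriv α 0 = -(2 * μ * c₀) / (μ ^ 2 + l ^ 2)) :
    (fun A : ℝ => (vortexField γ l μ c₀ (α A, β A, A)).2.2 -
      4 * γ * μ * c₀ / (μ ^ 2 + l ^ 2) * A ^ 2) =O[𝓝 0] fun A : ℝ => A ^ 3 := by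
  have h := ((hα.sub_deriv_mul_isBigO_sq hα0).mul
    (isBigO_refl (fun A : ℝ => A) (𝓝 0))).const_mul_left (-2 * γ)
  refine (h.congr_left fun A => ?_).congr_right fun A => by ring
  simp only [vortexField, hα1]
  ring

theorem mainTheorem2 (γ l μ c₀ : ℝ) (hγ : 1 < γ) (hμ : 0 < μ) (hc₀ : 0 < c₀) :
    -- exactly two equilibria
    ({p : ℝ × ℝ × ℝ | IsEquilibrium (vortexField γ l μ c₀) p} = {(0, 0, 0), (-μ, l, 0)} ∧
      ((0, 0, 0) : ℝ × ℝ × ℝ) ≠ (-μ, l, 0)) ∧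
    -- both are unstable
    IsUnstableEquilibrium (vortexField γ l μ c₀) (0, 0, 0) ∧
    IsUnstableEquilibrium (vortexField γ l μ c₀) (-μ, l, 0) ∧
    -- eigenvalues of the linearizations; the first one at `(-μ, l, 0)` is real and positive
    linearizationEigenvalues (vortexField γ l μ c₀) (-μ, l, 0) =
      {((2 * γ * μ : ℝ) : ℂ), (μ : ℂ) + l * Complex.I, (μ : ℂ) - l * Complex.I} ∧
    0 < 2 * γ * μ ∧
    linearizationEigenvalues (vortexField γ l μ c₀) (0, 0, 0) =
      {0, -(μ : ℂ) + l * Complex.I, -(μ : ℂ) - l * Complex.I} ∧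
    -- the reduced equation at the zero equilibrium
    (∀ α β : ℝ → ℝ, ContDiffAt ℝ 2 α 0 → ContDiffAt ℝ 2 β 0 → α 0 = 0 → β 0 = 0 →
      ((substitutionResidual (vortexField γ l μ c₀) α β =O[𝓝 0] fun A : ℝ => A ^ 2) ↔
        (deriv α 0 = -(2 * μ * c₀) / (μ ^ 2 + l ^ 2) ∧
          deriv β 0 = -(2 * l * c₀) / (μ ^ 2 + l ^ 2))) ∧
      ((substitutionResidual (vortexField γ l μ c₀) α β =O[𝓝 0] fun A : ℝ => A ^ 2) →
        (fun A : ℝ => (vortexField γ l μ c₀ (α A, β A, A)).2.2 -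
          4 * γ * μ * c₀ / (μ ^ 2 + l ^ 2) * A ^ 2) =O[𝓝 0] fun A : ℝ => A ^ 3)) := by
  have heq := isEquilibrium_vortexField_iff (l := l) (by positivity : γ ≠ 0) hμ.ne' hc₀.ne'
  have hγ0 : 0 < γ := by positivity
  refine ⟨⟨Set.ext fun p => heq p, fun h => ?_⟩,
    ⟨(heq _).mpr (Or.inl rfl), not_isLyapunovStable_vortexField_zero hγ0 hμ hc₀⟩,
    ⟨(heq _).mpr (Or.inr rfl), not_isLyapunovStable_vortexField_neg hγ0 hμ⟩, ?_,
    by positivity, ?_, fun α β hα hβ hα0 hβ0 => ?_⟩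
  · have h₁ : 0 = -μ := congrArg Prod.fst h
    linarith
  -- At `b = l` the coefficient `l - 2b` is `-l`, so the conjugate pair appears in the opposite
  -- order.
  · rw [linearizationEigenvalues_vortexField, Multiset.pair_comm ((μ : ℂ) + l * Complex.I)]
    congr 2
    · ring
    · push_cast; ring
    · congr 1
      push_cast; ring
  · rw [linearizationEigenvalues_vortexField]
    congr 2
    · simp
    · simp
    · simp
  · have h := substitutionResidual_isBigO_iff (γ := γ) (l := l) (c₀ := c₀) hμ.ne' hα hβ hα0 hβ0
    exact ⟨h, fun hR => vortexField_reduced_isBigO hα hα0 (h.mp hR).1⟩
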